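/- Fix $p\in(0,\tfrac12)$ and let $\log=\log_2$, $I(p)=1+p\log p+(1-p)\log(1-p)$. In the noisy binary search problem one is given $n$ sorted elements $a_1\le\dots\le a_n$ and an element $x$, and has to output the position of $x$, $\max(\{0\}\cup\{i: a_i<x\})$ (the index of its predecessor). The algorithm, deterministic or randomized, may adaptively ask noisy comparisons between $x$ and any $a_i$, in either order: the query $(s,t)$ returns the bit $\mathbf 1\{s<t\}$, flipped with probability $p$ independently for every query. Let $0<\delta<1$. Any algorithm (deterministic or randomized) for this problem with error probability at most $\delta$ makes at least $$(1-o(1))\left((1-\delta)\frac{\log n}{I(p)}+\frac{2\log\frac1\delta}{(1-2p)\log\frac{1-p}{p}}\right)$$ noisy comparisons in expectation. This holds even when the position of $x$ is uniformly random in $\{0,\dots,n\}$, with the error probability and the expected number of comparisons both averaged over the position. Here $\delta$ may depend on $n$, and the $o(1)$ depends only on $p$, $n$ and $\delta$ and tends to $0$ as $(1-\delta)\log n\to\infty$; in particular, for every fixed $c>0$ it tends to $0$ as $n\to\infty$, uniformly over all $\delta\in(0,1-c]$ and all algorithms. Precisely: for every $\varepsilon>0$ there is a $K=K(p,\varepsilon)$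 such that, whenever $(1-\delta)\log n\ge K$, the bound holds with $1-\varepsilon$ in place of $1-o(1)$. -/

import Mathlib

/-! Noisy binary search: the problem, adaptive randomized algorithms, error probability and
expected number of noisy comparisons. Sorted lists are indexed from `0`, so `a i` is the element
number `i + 1`. -/

namespace NoisySearch

open MeasureTheory
open scoped ENNReal

/-- The noisy comparisons an algorithm may ask for: of an element `a i` of the list with the
target `x`, in either order. -/
inductive Query (n : ℕ) : Type
  /-- is `a i < x`? -/
  | elemLtTarget (i : Fin n) : Query n
  /-- is `x < a i`? -/
  | targetLtElem (i : Fin n) : Query n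

/-- The correct (noise-free) answer to a query on the list `a` and target `x`. -/
def Query.truth {n : ℕ} {α : Type*} [LinearOrder α] (a : Fin n → α) (x : α) : Query n → Bool
  | .elemLtTarget i => decide (a i < x)
  | .targetLtElem i => decide (x < a i)

/-- The index (counted from `1`) of the largest element of the list below `x`,
or `0` if there is none. -/
def predIndex {n : ℕ} {α : Type*} [LinearOrder α] (a : Fin n → α) (x : α) : ℕ :=
  (Finset.univ.filter (fun i => a i < x)).sup (fun i => (i : ℕ) + 1)

/-- An adaptive search algorithm on lists of length `n` with random seed in `S`: the seed and the
answers received so far (oldest first) determine whether the algorithm makes another query or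
stops and outputs an index in `{0, …, n}`. A deterministic algorithm is the case where `S` is a
one-point space, or where `next` ignores the seed. -/
structure Algorithm (n : ℕ) (S : Type*) [MeasurableSpace S] where
  /-- the next action: a query, or an output -/
  next : S → List Bool → Query n ⊕ Fin (n + 1)
  /-- each action is a measurable function of the seed -/
  measurable_next : ∀ (h : List Bool) (b : Query n ⊕ Fin (n + 1)), MeasurableSet {s | next s h = b}

/-- The law of the noise: an independent sequence of bits, each `true` with probability `p`.
The answer to the `t`-th query is flipped iff the `t`-th bit is `true`. -/
noncomputable def noise (p : unitInterval) : Measure (ℕ → Bool) :=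
  Measure.infinitePi (fun _ : ℕ => ProbabilityTheory.bernoulliMeasure true false p)

namespace Algorithm

variable {n : ℕ} {S : Type*} [MeasurableSpace S] {α : Type*} [LinearOrder α]

/-- The answers received within the first `t` steps, on list `a`, target `x`, seed `s` and
noise `z`. Once the algorithm has stopped, the record no longer changes. -/
def answers (A : Algorithm n S) (a : Fin n → α) (x : α) (s : S) (z : ℕ → Bool) : ℕ → List Bool
  | 0 => []
  | t + 1 =>
    match A.next s (A.answers a x s z t) with
    | .inl q => A.answers a x s z t ++ [xor (q.truth a x) (z t)]
    | .inr _ => A.answers a x s z t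

/-- The algorithm stops and outputs `k`. -/
def Outputs (A : Algorithm n S) (a : Fin n → α) (x : α) (s : S) (z : ℕ → Bool)
    (k : Fin (n + 1)) : Prop :=
  ∃ t, A.next s (A.answers a x s z t) = .inr k

/-- The number of noisy comparisons made in a run (`∞` if the algorithm never stops). -/
noncomputable def numQueries (A : Algorithm n S) (a : Fin n → α) (x : α) (s : S) (z : ℕ → Bool) :
    ℝ≥0∞ :=
  ∑' t : ℕ, if (A.next s (A.answers a x s z t)).isLeft then 1 else 0

/-- The probability, over the seed and the noise, that the algorithm fails to output the index of
the predecessor of `x` (never stopping counts as a failure). -/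
noncomputable def errorProb (A : Algorithm n S) (μ : Measure S) (p : unitInterval)
    (a : Fin n → α) (x : α) : ℝ≥0∞ :=
  (μ.prod (noise p))
    {ω | ¬ ∃ k : Fin (n + 1), (k : ℕ) = predIndex a x ∧ A.Outputs a x ω.1 ω.2 k}

/-- The expected number of noisy comparisons, over the seed and the noise. -/
noncomputable def expectedQueries (A : Algorithm n S) (μ : Measure S) (p : unitInterval)
    (a : Fin n → α) (x : α) : ℝ≥0∞ :=
  ∫⁻ ω, A.numQueries a x ω.1 ω.2 ∂(μ.prod (noise p))

end Algorithm

/-- The average of `f` over a uniformly random position in `{0, …, n}`. -/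
noncomputable def uniformAverage (n : ℕ) (f : Fin (n + 1) → ℝ≥0∞) : ℝ≥0∞ :=
  (∑ k, f k) / (n + 1 : ℝ≥0∞)

/-- The capacity, in bits, of the binary symmetric channel with crossover probability `p`. -/
noncomputable def capacity (p : ℝ) : ℝ :=
  1 - (-(p * Real.logb 2 p) - (1 - p) * Real.logb 2 (1 - p))

end NoisySearch

/-! Track the unnormalized posterior weights `w` of the n+1 positions, starting from all ones. For a
functional homogeneous of degree one, the sum over both answers minus the old value is its expected
change, weighted by total mass. Two such functionals measure progress. Negative entropy gains at
most the capacity per query and has to rise by about (1-δ) log n. The Jeffreys divergence between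
neighbouring positions gains only at the pair where the noise-free answers jump, at most `noiseDiv`
per query, and has to reach about 2 log(1/δ), because the output must be separated from two
neighbours.

The two requirements add up only if one query cannot serve both fully. Normalized by their maxima,
the entropy gain is small unless both sides of the query carry mass
(`negEntropy_reweight_le_massOf`), and the divergence gain is the mass of the two positions at the
jump. When both gains are substantial, the collision probability grows by a definite amount
(`collision_reweight`); since it never exceeds 1, this can account for only a bounded total.
Subtracting a large multiple of it gives a potential that gains at most 1+ε per query
(`potential_reweight_le`), at the price of a constant depending on p and ε.

The terminal bounds `negEntropy_ge` and `neighborDiv_ge` are affine in the error mass, so they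
average over leaves, positions and seeds. `tree_bound` runs the potential along a truncated decision
tree, `Algorithm.ofReal_totalGain_le` integrates over the seed and removes the truncation, and
`main_term_le` absorbs the constants. -/

namespace NoisySearch

open Finset

/-! ### Unnormalized posterior weights and their update -/

/-- The weights after the answer `b` to a query with noise-free answers `τ`. -/
noncomputable def reweight {ι : Type*} (p : ℝ) (τ : ι → Bool) (b : Bool) (w : ι → ℝ) : ι → ℝ :=
  fun k => (if τ k = b then 1 - p else p) * w k

/-- The total mass of the weights on which the noise-free answer is `b`. -/
noncomputable def massOf {ι : Type*} [Fintype ι] (τ : ι → Bool) (b : Bool) (w : ι → ℝ) : ℝ :=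
  ∑ k, if τ k = b then w k else 0

section Reweight

variable {ι : Type*} {p : ℝ} {τ : ι → Bool} {w : ι → ℝ}

lemma reweight_pos (hp0 : 0 < p) (hp1 : p < 1) (hw : ∀ k, 0 < w k) (b : Bool) (k : ι) :
    0 < reweight p τ b w k := by
  unfold reweight
  split_ifs
  · exact mul_pos (by linarith) (hw k)
  · exact mul_pos hp0 (hw k)

lemma reweight_true_add_false (k : ι) :
    reweight p τ true w k + reweight p τ false w k = w k := by
  unfold reweight
  cases τ k <;> simp <;> ring

lemma reweight_mul_log (hp0 : 0 < p) (hp1 : p < 1) (hw : ∀ k, 0 < w k) (k : ι) :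
    reweight p τ true w k * Real.log (reweight p τ true w k) +
      reweight p τ false w k * Real.log (reweight p τ false w k) =
    w k * Real.log (w k) + w k * (p * Real.log p + (1 - p) * Real.log (1 - p)) := by
  have h1 := Real.log_mul hp0.ne' (hw k).ne'
  have h2 := Real.log_mul (sub_pos.2 hp1).ne' (hw k).ne'
  unfold reweight
  cases τ k <;> simp [h1, h2] <;> ring

variable [Fintype ι]

lemma massOf_true_add_false : massOf τ true w + massOf τ false w = ∑ k, w k := by
  unfold massOf
  rw [← sum_add_distrib]
  refine sum_congr rfl fun k _ => ?_
  cases τ k <;> simp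

lemma sum_reweight (b : Bool) :
    ∑ k, reweight p τ b w k = (1 - p) * massOf τ b w + p * massOf τ (!b) w := by
  unfold massOf reweight
  rw [mul_sum, mul_sum, ← sum_add_distrib]
  refine sum_congr rfl fun k _ => ?_
  cases τ k <;> cases b <;> simp

lemma massOf_nonneg (hw : ∀ k, 0 < w k) (b : Bool) : 0 ≤ massOf τ b w :=
  sum_nonneg fun k _ => by split_ifs <;> simp [(hw k).le]

lemma le_massOf (hw : ∀ k, 0 < w k) (k : ι) : w k ≤ massOf τ (τ k) w := by
  have := single_le_sum (f := fun i => if τ i = τ k then w i else 0)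
    (fun i _ => by split_ifs <;> simp [(hw i).le]) (mem_univ k)
  simpa [massOf] using this

end Reweight

/-! ### The entropy functional -/

/-- The unnormalized negative entropy, in nats. -/
noncomputable def negEntropy {ι : Type*} [Fintype ι] (w : ι → ℝ) : ℝ :=
  ∑ k, w k * Real.log (w k) - (∑ k, w k) * Real.log (∑ k, w k)

/-- Gibbs' inequality on two points. -/
lemma mul_log_add_mul_log_le {x y α β : ℝ} (hx : 0 < x) (hy : 0 < y) (hα : 0 < α) (hβ : 0 < β)
    (h : α + β = 1) :
    (x + y) * Real.log (x + y) - x * Real.log x - y * Real.log y ≤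
      -(x * Real.log α) - y * Real.log β := by
  have hxy : 0 < x + y := by linarith
  have key : ∀ {z γ : ℝ}, 0 < z → 0 < γ →
      z * Real.log γ + z * Real.log (x + y) - z * Real.log z ≤ γ * (x + y) - z := by
    intro z γ hz hγ
    have h1 := Real.log_le_sub_one_of_pos (show 0 < γ * (x + y) / z by positivity)
    rw [Real.log_div (by positivity) hz.ne', Real.log_mul hγ.ne' hxy.ne'] at h1
    have h2 := mul_le_mul_of_nonneg_left h1 hz.le
    have h3 : z * (γ * (x + y) / z - 1) = γ * (x + y) - z := by field_simp
    linarith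
  have h1 := key hx hα
  have h2 := key hy hβ
  have h3 : α * (x + y) + β * (x + y) = x + y := by rw [← add_mul, h, one_mul]
  linarith

section Entropy

variable {ι : Type*} [Fintype ι] {p : ℝ} {τ : ι → Bool} {w : ι → ℝ}

lemma negEntropy_reweight (hp0 : 0 < p) (hp1 : p < 1) (hw : ∀ k, 0 < w k) :
    negEntropy (reweight p τ true w) + negEntropy (reweight p τ false w) - negEntropy w =
      (∑ k, w k) * (p * Real.log p + (1 - p) * Real.log (1 - p)) +
      ((∑ k, w k) * Real.log (∑ k, w k) -
        (∑ k, reweight p τ true w k) * Real.log (∑ k, reweight p τ true w k) -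
        (∑ k, reweight p τ false w k) * Real.log (∑ k, reweight p τ false w k)) := by
  have h := sum_congr (s₁ := univ) rfl fun k _ => reweight_mul_log (τ := τ) hp0 hp1 hw k
  rw [sum_add_distrib, sum_add_distrib, ← sum_mul] at h
  unfold negEntropy
  linarith

variable [Nonempty ι]

/-- The gain is the mutual information of position and answer; replacing the law of the answer by
any reference law (α, β) can only increase the expression. Both bounds below are choices of this
law. -/
lemma negEntropy_reweight_le_of_pos (hp0 : 0 < p) (hp1 : p < 1) (hw : ∀ k, 0 < w k) {α β : ℝ}
    (hα : 0 < α) (hβ : 0 < β) (h : α + β = 1) :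
    negEntropy (reweight p τ true w) + negEntropy (reweight p τ false w) - negEntropy w ≤
      (∑ k, w k) * (p * Real.log p + (1 - p) * Real.log (1 - p)) -
      (∑ k, reweight p τ true w k) * Real.log α -
      (∑ k, reweight p τ false w k) * Real.log β := by
  have hs : ∑ k, w k = ∑ k, reweight p τ true w k + ∑ k, reweight p τ false w k := by
    rw [← sum_add_distrib]
    exact sum_congr rfl fun k _ => (reweight_true_add_false k).symm
  rw [negEntropy_reweight hp0 hp1 hw]
  have := mul_log_add_mul_log_le
    (sum_pos (fun k _ => reweight_pos (τ := τ) hp0 hp1 hw true k) univ_nonempty)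
    (sum_pos (fun k _ => reweight_pos (τ := τ) hp0 hp1 hw false k) univ_nonempty) hα hβ h
  rw [← hs] at this
  linarith

lemma negEntropy_reweight_le_capacity (hp0 : 0 < p) (hp1 : p < 1) (hw : ∀ k, 0 < w k) :
    negEntropy (reweight p τ true w) + negEntropy (reweight p τ false w) - negEntropy w ≤
      (Real.log 2 + p * Real.log p + (1 - p) * Real.log (1 - p)) * ∑ k, w k := by
  have h := negEntropy_reweight_le_of_pos (τ := τ) hp0 hp1 hw (α := 1 / 2) (β := 1 / 2)
    (by norm_num) (by norm_num) (by norm_num)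
  have hs : ∑ k, w k = ∑ k, reweight p τ true w k + ∑ k, reweight p τ false w k := by
    rw [← sum_add_distrib]
    exact sum_congr rfl fun k _ => (reweight_true_add_false k).symm
  have h2 : Real.log (1 / 2) = - Real.log 2 := by simp
  rw [h2] at h
  have h3 : (∑ k, w k) * Real.log 2 = (∑ k, reweight p τ true w k) * Real.log 2 +
    (∑ k, reweight p τ false w k) * Real.log 2 := by rw [hs]; ring
  linarith

lemma negEntropy_reweight_le_massOf (hp0 : 0 < p) (hp1 : p < 1) (hw : ∀ k, 0 < w k) (b : Bool) :
    negEntropy (reweight p τ true w) + negEntropy (reweight p τ false w) - negEntropy w ≤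
      (1 - 2 * p) * (Real.log (1 - p) - Real.log p) * massOf τ b w := by
  have hs := massOf_true_add_false (τ := τ) (w := w)
  cases b
  -- The reference law is the true answer law on the side opposite to `b`, so only the mass on side
  -- `b` contributes a divergence.
  · have h := negEntropy_reweight_le_of_pos (τ := τ) hp0 hp1 hw (α := 1 - p) (β := p)
      (by linarith) hp0 (by ring)
    rw [sum_reweight, sum_reweight, ← hs] at h
    simp only [Bool.not_true, Bool.not_false] at h
    refine h.trans (le_of_eq ?_)
    ring
  · have h := negEntropy_reweight_le_of_pos (τ := τ) hp0 hp1 hw (α := p) (β := 1 - p)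
      hp0 (by linarith) (by ring)
    rw [sum_reweight, sum_reweight, ← hs] at h
    simp only [Bool.not_true, Bool.not_false] at h
    refine h.trans (le_of_eq ?_)
    ring

end Entropy

/-! ### The quadratic functional -/

/-- The unnormalized collision probability. -/
noncomputable def collision {ι : Type*} [Fintype ι] (w : ι → ℝ) : ℝ :=
  (∑ k, w k ^ 2) / ∑ k, w k

lemma collision_le_sum {ι : Type*} [Fintype ι] [Nonempty ι] {w : ι → ℝ} (hw : ∀ k, 0 < w k) :
    collision w ≤ ∑ k, w k := by
  have hW : 0 < ∑ k, w k := sum_pos (fun k _ => hw k) univ_nonempty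
  unfold collision
  rw [div_le_iff₀ hW, sum_mul]
  refine sum_le_sum fun k _ => ?_
  rw [pow_two]
  exact mul_le_mul_of_nonneg_left (single_le_sum (fun i _ => (hw i).le) (mem_univ k)) (hw k).le

lemma collision_nonneg {ι : Type*} [Fintype ι] {w : ι → ℝ} (hw : ∀ k, 0 < w k) :
    0 ≤ collision w :=
  div_nonneg (sum_nonneg fun _ _ => sq_nonneg _) (sum_nonneg fun k _ => (hw k).le)

/-- The right side is an exact square over a product of A+B and the two answer masses. These masses
sum to A+B, so AM-GM bounds their product. -/
lemma collision_coeff_ge {p A B : ℝ} (hp0 : 0 < p) (hp1 : p < 1) (hA : 0 ≤ A) (hB : 0 ≤ B)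
    (hAB : 0 < A + B) :
    4 * (1 - 2 * p) ^ 2 * B ^ 2 / (A + B) ^ 3 ≤
      (1 - p) ^ 2 / ((1 - p) * A + p * B) + p ^ 2 / ((1 - p) * B + p * A) - 1 / (A + B) := by
  have hq : 0 < 1 - p := sub_pos.2 hp1
  have h1 : 0 < (1 - p) * A + p * B := by
    rcases hA.lt_or_eq with h | h
    · positivity
    · have : 0 < B := by linarith
      positivity
  have h0 : 0 < (1 - p) * B + p * A := by
    rcases hA.lt_or_eq with h | h
    · positivity
    · have : 0 < B := by linarith
      positivity
  have heq : (1 - p) ^ 2 / ((1 - p) * A + p * B) + p ^ 2 / ((1 - p) * B + p * A) - 1 / (A + B) =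
      (1 - 2 * p) ^ 2 * B ^ 2 /
        ((A + B) * (((1 - p) * A + p * B) * ((1 - p) * B + p * A))) := by
    field_simp
    ring
  rw [heq]
  have h4 : 4 * (((1 - p) * A + p * B) * ((1 - p) * B + p * A)) ≤ (A + B) ^ 2 := by
    nlinarith [sq_nonneg (((1 - p) * A + p * B) - ((1 - p) * B + p * A))]
  rw [div_le_div_iff₀ (by positivity) (by positivity)]
  have := mul_le_mul_of_nonneg_left h4
    (show 0 ≤ (1 - 2 * p) ^ 2 * B ^ 2 * (A + B) by positivity)
  linarith

section Collision

variable {ι : Type*} [Fintype ι] {p : ℝ} {τ : ι → Bool} {w : ι → ℝ}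

lemma collision_reweight [Nonempty ι] (hp0 : 0 < p) (hp1 : p < 1) (hw : ∀ k, 0 < w k) :
    ∑ k, 4 * (1 - 2 * p) ^ 2 * massOf τ (!τ k) w ^ 2 / (∑ i, w i) ^ 3 * w k ^ 2 ≤
      collision (reweight p τ true w) + collision (reweight p τ false w) - collision w := by
  unfold collision
  rw [sum_div, sum_div, sum_div, ← sum_add_distrib, ← sum_sub_distrib]
  refine sum_le_sum fun k _ => ?_
  have hs := massOf_true_add_false (τ := τ) (w := w)
  have hW : 0 < ∑ k, w k := sum_pos (fun k _ => hw k) univ_nonempty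
  have hA := massOf_nonneg (τ := τ) hw true
  have hB := massOf_nonneg (τ := τ) hw false
  rw [sum_reweight, sum_reweight]
  rw [← hs] at hW ⊢
  simp only [Bool.not_true, Bool.not_false]
  cases hk : τ k
  · have h := collision_coeff_ge hp0 hp1 hB hA (by linarith)
    have h2 := mul_le_mul_of_nonneg_right h (sq_nonneg (w k))
    simp only [reweight, hk]
    simp only [Bool.not_false, reduceCtorEq, if_false, if_true]
    rw [add_comm (massOf τ false w)] at h2
    refine h2.trans (le_of_eq ?_)
    ring
  · have h := collision_coeff_ge hp0 hp1 hA hB hW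
    have h2 := mul_le_mul_of_nonneg_right h (sq_nonneg (w k))
    simp only [reweight, hk]
    simp only [Bool.not_true, reduceCtorEq, if_false, if_true]
    refine h2.trans (le_of_eq ?_)
    ring

end Collision

/-! ### The Jeffreys divergence between neighbours -/

/-- The sum, over pairs of neighbouring positions, of the Jeffreys divergence of the weights. -/
noncomputable def neighborDiv {n : ℕ} (w : Fin (n + 1) → ℝ) : ℝ :=
  ∑ i : Fin n, (w i.succ - w i.castSucc) * (Real.log (w i.succ) - Real.log (w i.castSucc))

lemma sub_mul_log_sub_nonneg {x y : ℝ} (hx : 0 < x) (hy : 0 < y) :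
    0 ≤ (x - y) * (Real.log x - Real.log y) := by
  rcases le_total x y with h | h
  · exact mul_nonneg_of_nonpos_of_nonpos (by linarith) (by linarith [Real.log_le_log hx h])
  · exact mul_nonneg (by linarith) (by linarith [Real.log_le_log hy h])

lemma neighborDiv_nonneg {n : ℕ} {w : Fin (n + 1) → ℝ} (hw : ∀ k, 0 < w k) :
    0 ≤ neighborDiv w :=
  sum_nonneg fun _ _ => sub_mul_log_sub_nonneg (hw _) (hw _)

/-- On a pair with equal noise-free answers the log-ratio is unchanged and the weights add up again;
on a jump it shifts by plus or minus log((1-p)/p). -/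
lemma neighborDiv_reweight {n : ℕ} {p : ℝ} {τ : Fin (n + 1) → Bool} {w : Fin (n + 1) → ℝ}
    (hp0 : 0 < p) (hp1 : p < 1) (hw : ∀ k, 0 < w k) :
    neighborDiv (reweight p τ true w) + neighborDiv (reweight p τ false w) - neighborDiv w =
      ∑ i : Fin n, if τ i.castSucc ≠ τ i.succ then
        (1 - 2 * p) * (Real.log (1 - p) - Real.log p) * (w i.succ + w i.castSucc) else 0 := by
  unfold neighborDiv
  rw [← sum_add_distrib, ← sum_sub_distrib]
  refine sum_congr rfl fun i _ => ?_
  have h1 := Real.log_mul hp0.ne' (hw i.succ).ne'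
  have h2 := Real.log_mul (sub_pos.2 hp1).ne' (hw i.succ).ne'
  have h3 := Real.log_mul hp0.ne' (hw i.castSucc).ne'
  have h4 := Real.log_mul (sub_pos.2 hp1).ne' (hw i.castSucc).ne'
  unfold reweight
  cases τ i.succ <;> cases τ i.castSucc <;> simp [h1, h2, h3, h4] <;> ring

end NoisySearch

namespace NoisySearch

open Finset

/-! ### The potential and its change in one query -/

/-- The capacity of the channel in nats. -/
noncomputable def natCapacity (p : ℝ) : ℝ :=
  Real.log 2 + p * Real.log p + (1 - p) * Real.log (1 - p)

/-- The Jeffreys divergence of the two noise distributions, in nats. -/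
noncomputable def noiseDiv (p : ℝ) : ℝ :=
  (1 - 2 * p) * (Real.log (1 - p) - Real.log p)

lemma natCapacity_pos {p : ℝ} (hp1 : p < 1 / 2) : 0 < natCapacity p := by
  have h := Real.binEntropy_lt_log_two.2 (show p ≠ 2⁻¹ by norm_num at hp1 ⊢; exact hp1.ne)
  rw [Real.binEntropy_eq_negMulLog_add_negMulLog_one_sub] at h
  simp only [Real.negMulLog] at h
  unfold natCapacity
  linarith

lemma noiseDiv_pos {p : ℝ} (hp0 : 0 < p) (hp1 : p < 1 / 2) : 0 < noiseDiv p :=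
  mul_pos (by linarith) (sub_pos.2 (Real.log_lt_log hp0 (by linarith)))

/-- The potential: negative entropy and neighbour divergence, normalized by their maximal gain per
query, minus a multiple of the collision probability. -/
noncomputable def potential {n : ℕ} (p C : ℝ) (w : Fin (n + 1) → ℝ) : ℝ :=
  negEntropy w / natCapacity p + neighborDiv w / noiseDiv p - C * collision w

/-- Here `A` and `B` are the masses of the two sides, `u` and `v` the weights next to the jump, `g`
the normalized entropy gain and `G` the collision gain. Either one side is light and `g` is
negligible, or `G` pays for `u + v`. -/
lemma combined_gain_le {M κ ε A B u v g G : ℝ} (hM : 0 < M) (hκ : 0 < κ) (hε : 0 < ε)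
    (hu : 0 < u) (hv : 0 < v) (huA : u ≤ A) (hvB : v ≤ B) (hg : g ≤ A + B) (hgA : g ≤ M * A)
    (hgB : g ≤ M * B) (hG : κ * (u ^ 2 * B ^ 2 + v ^ 2 * A ^ 2) / (A + B) ^ 3 ≤ G) :
    g + (u + v) - 1 / (2 * ε * κ * (ε / M) ^ 2) * G ≤ (1 + ε) * (A + B) := by
  have hA : 0 < A := hu.trans_le huA
  have hB : 0 < B := hv.trans_le hvB
  have hW : 0 < A + B := by linarith
  have hG0 : 0 ≤ G := le_trans (by positivity) hG
  have hC0 : 0 ≤ 1 / (2 * ε * κ * (ε / M) ^ 2) * G := by positivity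
  set η := ε / M with hη
  have hη0 : 0 < η := div_pos hε hM
  have hMη : M * η = ε := by rw [hη]; field_simp
  by_cases hAs : A ≤ η * (A + B)
  · have : M * A ≤ ε * (A + B) := by
      rw [← hMη, mul_assoc]
      exact mul_le_mul_of_nonneg_left hAs hM.le
    linarith
  by_cases hBs : B ≤ η * (A + B)
  · have : M * B ≤ ε * (A + B) := by
      rw [← hMη, mul_assoc]
      exact mul_le_mul_of_nonneg_left hBs hM.le
    linarith
  push Not at hAs hBs
  have h1 : (η * (A + B)) ^ 2 ≤ A ^ 2 := pow_le_pow_left₀ (by positivity) hAs.le 2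
  have h2 : (η * (A + B)) ^ 2 ≤ B ^ 2 := pow_le_pow_left₀ (by positivity) hBs.le 2
  have h3 : (u + v) ^ 2 / 2 * (η * (A + B)) ^ 2 ≤ u ^ 2 * B ^ 2 + v ^ 2 * A ^ 2 := by
    have h4 : (u + v) ^ 2 / 2 ≤ u ^ 2 + v ^ 2 := by nlinarith [sq_nonneg (u - v)]
    have h5 := mul_le_mul_of_nonneg_right h4 (sq_nonneg (η * (A + B)))
    have h6 := mul_le_mul_of_nonneg_left h2 (sq_nonneg u)
    have h7 := mul_le_mul_of_nonneg_left h1 (sq_nonneg v)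
    linarith
  have h4 : (u + v) ^ 2 / (4 * ε * (A + B)) ≤ 1 / (2 * ε * κ * η ^ 2) * G := by
    have h5 : κ * ((u + v) ^ 2 / 2 * (η * (A + B)) ^ 2) / (A + B) ^ 3 ≤ G :=
      le_trans (by gcongr) hG
    refine le_trans (le_of_eq ?_) (mul_le_mul_of_nonneg_left h5 (by positivity))
    field_simp
    norm_num
  -- AM-GM; the factor in front of `G` was chosen so that `G` covers exactly this quadratic term.
  have h5 : u + v ≤ ε * (A + B) + (u + v) ^ 2 / (4 * ε * (A + B)) := by
    have : ε * (A + B) + (u + v) ^ 2 / (4 * ε * (A + B)) - (u + v) =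
        (2 * ε * (A + B) - (u + v)) ^ 2 / (4 * ε * (A + B)) := by
      field_simp
      ring
    have h6 : 0 ≤ (2 * ε * (A + B) - (u + v)) ^ 2 / (4 * ε * (A + B)) := by positivity
    linarith
  linarith

/-- `τ` changes its value between neighbours at most once. -/
def SingleJump {n : ℕ} (τ : Fin (n + 1) → Bool) : Prop :=
  ∀ i j : Fin n, τ i.castSucc ≠ τ i.succ → τ j.castSucc ≠ τ j.succ → i = j

lemma SingleJump.of_monotone {n : ℕ} {τ : Fin (n + 1) → Bool} (h : Monotone τ) :
    SingleJump τ := by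
  have key : ∀ i j : Fin n, τ i.castSucc ≠ τ i.succ → τ j.castSucc ≠ τ j.succ → ¬ i < j := by
    intro i j hi hj hij
    have h1 := h (show i.castSucc ≤ i.succ from (Fin.castSucc_lt_succ).le)
    have h2 := h (show i.succ ≤ j.castSucc from by
      rw [Fin.le_def, Fin.val_succ, Fin.val_castSucc]; exact hij)
    have h3 := h (show j.castSucc ≤ j.succ from (Fin.castSucc_lt_succ).le)
    revert h1 h2 h3 hi hj
    cases τ i.castSucc <;> cases τ i.succ <;> cases τ j.castSucc <;> cases τ j.succ <;> simp
  intro i j hi hj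
  exact le_antisymm (not_lt.1 (key j i hj hi)) (not_lt.1 (key i j hi hj))

lemma SingleJump.of_antitone {n : ℕ} {τ : Fin (n + 1) → Bool} (h : Antitone τ) :
    SingleJump τ := by
  have h2 : SingleJump fun k => !(τ k) := SingleJump.of_monotone fun i j hij => by
    have := h hij
    revert this
    cases τ i <;> cases τ j <;> simp
  intro i j hi hj
  exact h2 i j (by simpa using hi) (by simpa using hj)

/-- The constant in front of the collision probability. -/
noncomputable def collisionWeight (p ε : ℝ) : ℝ :=
  1 / (2 * ε * (4 * (1 - 2 * p) ^ 2) * (ε / (noiseDiv p / natCapacity p)) ^ 2)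

lemma collisionWeight_nonneg {p ε : ℝ} (hε : 0 < ε) : 0 ≤ collisionWeight p ε := by
  unfold collisionWeight
  positivity

/-- With a jump, the two positions next to it lie on opposite sides, and their two terms in
`collision_reweight` suffice for `combined_gain_le`. Without one, the divergence is constant and the
capacity bound is enough. -/
lemma potential_reweight_le {n : ℕ} {p ε : ℝ} {τ : Fin (n + 1) → Bool} {w : Fin (n + 1) → ℝ}
    (hp0 : 0 < p) (hp1 : p < 1 / 2) (hε : 0 < ε) (hτ : SingleJump τ) (hw : ∀ k, 0 < w k) :
    potential p (collisionWeight p ε) (reweight p τ true w) +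
      potential p (collisionWeight p ε) (reweight p τ false w) ≤
    potential p (collisionWeight p ε) w + (1 + ε) * ∑ k, w k := by
  have hp1' : p < 1 := by linarith
  have hI := natCapacity_pos hp1
  have hD := noiseDiv_pos hp0 hp1
  have hW : 0 < ∑ k, w k := sum_pos (fun k _ => hw k) univ_nonempty
  have hs := massOf_true_add_false (τ := τ) (w := w)
  have hQ := collision_reweight (τ := τ) hp0 hp1' hw
  have hL := neighborDiv_reweight (τ := τ) hp0 hp1' hw
  have hN := negEntropy_reweight_le_capacity (τ := τ) hp0 hp1' hw
  have hNm := negEntropy_reweight_le_massOf (τ := τ) hp0 hp1' hw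
  set dN := negEntropy (reweight p τ true w) + negEntropy (reweight p τ false w) - negEntropy w
    with hdN
  set dL := neighborDiv (reweight p τ true w) + neighborDiv (reweight p τ false w) -
    neighborDiv w with hdL
  set dQ := collision (reweight p τ true w) + collision (reweight p τ false w) - collision w
    with hdQ
  suffices h : dN / natCapacity p + dL / noiseDiv p - collisionWeight p ε * dQ ≤
      (1 + ε) * ∑ k, w k by
    have heq : dN / natCapacity p + dL / noiseDiv p - collisionWeight p ε * dQ =
      potential p (collisionWeight p ε) (reweight p τ true w) +
      potential p (collisionWeight p ε) (reweight p τ false w) -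
      potential p (collisionWeight p ε) w := by
      rw [hdN, hdL, hdQ]
      unfold potential
      ring
    linarith
  have hg : dN / natCapacity p ≤ ∑ k, w k := by
    rw [div_le_iff₀ hI, mul_comm]
    exact hN
  have hgm : ∀ b, dN / natCapacity p ≤ noiseDiv p / natCapacity p * massOf τ b w := by
    intro b
    rw [div_mul_eq_mul_div]
    exact div_le_div_of_nonneg_right (hNm b) hI.le
  have hterm : ∀ k, 0 ≤ 4 * (1 - 2 * p) ^ 2 * massOf τ (!τ k) w ^ 2 / (∑ i, w i) ^ 3 * w k ^ 2 :=
    fun k => by positivity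
  by_cases hj : ∃ i : Fin n, τ i.castSucc ≠ τ i.succ
  · obtain ⟨i, hi⟩ := hj
    have hL' : dL / noiseDiv p = w i.succ + w i.castSucc := by
      rw [hL, sum_eq_single i, if_pos hi]
      · change noiseDiv p * _ / _ = _
        field_simp
      · intro j _ hji
        rw [if_neg]
        exact fun hj => hji (hτ j i hj hi)
      · simp
    have hQ2 : 4 * (1 - 2 * p) ^ 2 * massOf τ (!τ i.succ) w ^ 2 / (∑ i, w i) ^ 3 * w i.succ ^ 2 +
        4 * (1 - 2 * p) ^ 2 * massOf τ (!τ i.castSucc) w ^ 2 / (∑ i, w i) ^ 3 *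
          w i.castSucc ^ 2 ≤ dQ :=
      (add_le_sum (fun k _ => hterm k) (mem_univ _) (mem_univ _)
        (Fin.castSucc_lt_succ).ne').trans hQ
    have hu := le_massOf (τ := τ) hw i.succ
    have hv := le_massOf (τ := τ) hw i.castSucc
    have h1 : (!τ i.succ) = τ i.castSucc := by
      revert hi; cases τ i.succ <;> cases τ i.castSucc <;> simp
    have h2 : (!τ i.castSucc) = τ i.succ := by
      revert hi; cases τ i.succ <;> cases τ i.castSucc <;> simp
    rw [h1, h2] at hQ2
    have hs' : massOf τ (τ i.succ) w + massOf τ (τ i.castSucc) w = ∑ k, w k := by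
      rw [← hs, ← h1]
      cases τ i.succ <;> simp [add_comm]
    have hne : (1 - 2 * p) ≠ 0 := by linarith
    have := combined_gain_le (M := noiseDiv p / natCapacity p) (κ := 4 * (1 - 2 * p) ^ 2)
      (ε := ε) (G := dQ) (div_pos hD hI) (by positivity) hε (hw _) (hw _) hu hv
      (by rw [hs']; exact hg) (hgm _) (hgm _)
      (by
        refine le_trans (le_of_eq ?_) hQ2
        rw [hs']
        ring)
    rw [hs'] at this
    rw [hL']
    exact this
  · push Not at hj
    have hL' : dL = 0 := by
      rw [hL]
      exact sum_eq_zero fun i _ => by simp [hj i]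
    have hQ' : 0 ≤ dQ := (sum_nonneg fun k _ => hterm k).trans hQ
    have := mul_nonneg (collisionWeight_nonneg (p := p) hε) hQ'
    have h3 : 0 ≤ ε * ∑ k, w k := by positivity
    rw [hL', zero_div]
    linarith

/-! ### The potential when the algorithm stops -/

/-- Fano's inequality: Gibbs' inequality against the mixture of half a point mass at `j` and half
the uniform law. -/
lemma negEntropy_ge {n : ℕ} {w : Fin (n + 1) → ℝ} (hw : ∀ k, 0 < w k) (j : Fin (n + 1)) :
    -((∑ k, w k) * Real.log 2) - (∑ k, w k - w j) * Real.log (n + 1) ≤ negEntropy w := by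
  have hW : 0 < ∑ k, w k := sum_pos (fun k _ => hw k) univ_nonempty
  have hn : (0 : ℝ) < n + 1 := by positivity
  set W := ∑ k, w k with hWd
  have hterm : ∀ k, w k - ((if k = j then W / 2 else 0) + W / (2 * (n + 1))) ≤
      w k * Real.log (w k) - w k * Real.log W + w k * Real.log 2 +
        (w k - if k = j then w k else 0) * Real.log (n + 1) := by
    intro k
    have key : ∀ q : ℝ, 0 < q →
        w k - W * q ≤ w k * Real.log (w k) - w k * Real.log W - w k * Real.log q := by
      intro q hq
      have h1 := Real.log_le_sub_one_of_pos (show 0 < W * q / w k by have := hw k; positivity)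
      rw [Real.log_div (by positivity) (hw k).ne', Real.log_mul hW.ne' hq.ne'] at h1
      have h2 := mul_le_mul_of_nonneg_left h1 (hw k).le
      have h3 : w k * (W * q / w k - 1) = W * q - w k := by
        have := (hw k).ne'
        field_simp
      linarith
    have hpos : 0 ≤ W / (2 * ((n : ℝ) + 1)) := by positivity
    split_ifs with h
    · have := key (1 / 2) (by norm_num)
      rw [Real.log_div one_ne_zero two_ne_zero, Real.log_one] at this
      linarith
    · have := key (1 / (2 * (n + 1))) (by positivity)
      rw [Real.log_div one_ne_zero (by positivity), Real.log_one,
        Real.log_mul two_ne_zero hn.ne'] at this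
      have h4 : W * (1 / (2 * ((n : ℝ) + 1))) = W / (2 * (n + 1)) := by ring
      linarith
  have h := sum_le_sum (s := univ) fun k _ => hterm k
  simp only [sum_add_distrib, sum_sub_distrib, ← sum_mul, sum_ite_eq', mem_univ, if_true,
    sum_const, card_univ, Fintype.card_fin, nsmul_eq_mul] at h
  rw [← hWd] at h
  have h5 : ((n + 1 : ℕ) : ℝ) * (W / (2 * (n + 1))) = W / 2 := by
    push_cast
    field_simp
  unfold negEntropy
  rw [← hWd]
  linarith

/-- The output has weight `W - e` and its neighbour `y` at most the error mass `e`. The tangent of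
the logarithm at δ makes the bound affine in `e`, with no need for the error at an individual leaf
to be near δ. -/
lemma edge_div_ge {W e y δ : ℝ} (hδ0 : 0 < δ) (hδ1 : δ < 1) (he : e < W) (hy : 0 < y)
    (hye : y ≤ e) :
    (W - 2 * e) * -Real.log δ - e / δ ≤ (W - e - y) * (Real.log (W - e) - Real.log y) := by
  have he0 : 0 < e := hy.trans_le hye
  have hW : 0 < W := he0.trans he
  have hx : 0 < W - e := by linarith
  have hΛ : 0 < -Real.log δ := neg_pos.2 (Real.log_neg hδ0 hδ1)
  by_cases h : W ≤ 2 * e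
  · have h1 := sub_mul_log_sub_nonneg hx hy
    have h2 : (W - 2 * e) * -Real.log δ ≤ 0 :=
      mul_nonpos_of_nonpos_of_nonneg (by linarith) hΛ.le
    have h3 : 0 ≤ e / δ := by positivity
    linarith
  · push Not at h
    have h1 := Real.log_le_sub_one_of_pos (show 0 < e / W / δ by positivity)
    rw [Real.log_div (by positivity) hδ0.ne', Real.log_div he0.ne' hW.ne'] at h1
    have h2 : Real.log W - Real.log 2 ≤ Real.log (W - e) := by
      rw [← Real.log_div hW.ne' two_ne_zero]
      exact Real.log_le_log (by positivity) (by linarith)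
    have h3 := Real.log_le_log hy hye
    -- The spare 1 in the tangent bound pays for replacing `W - e` by `W / 2`.
    have h4 : Real.log 2 ≤ 1 := by linarith [Real.log_le_sub_one_of_pos (zero_lt_two' ℝ)]
    have h5 : -Real.log δ - e / W / δ ≤ Real.log (W - e) - Real.log y := by linarith
    have h6 : 0 ≤ Real.log (W - e) - Real.log y :=
      sub_nonneg.2 (Real.log_le_log hy (by linarith))
    have h7 : (W - 2 * e) * (Real.log (W - e) - Real.log y) ≤
        (W - e - y) * (Real.log (W - e) - Real.log y) :=
      mul_le_mul_of_nonneg_right (by linarith) h6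
    have h8 := mul_le_mul_of_nonneg_left h5 (show 0 ≤ W - 2 * e by linarith)
    have h9 : (W - 2 * e) * (e / W / δ) ≤ e / δ := by
      have : e / δ - (W - 2 * e) * (e / W / δ) = 2 * e * (e / W / δ) := by
        field_simp
        ring
      have h10 : 0 ≤ 2 * e * (e / W / δ) := by positivity
      linarith
    linarith

lemma neighborDiv_ge {n : ℕ} {w : Fin (n + 1) → ℝ} (hw : ∀ k, 0 < w k) {δ : ℝ} (hδ0 : 0 < δ)
    (hδ1 : δ < 1) (j : Fin (n + 1)) :
    2 * ((∑ k, w k) - 2 * (∑ k, w k - w j)) * -Real.log δ - 2 * (∑ k, w k - w j) / δ -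
      2 * -Real.log δ * (w 0 + w (Fin.last n)) ≤ neighborDiv w := by
  have hΛ : 0 < -Real.log δ := neg_pos.2 (Real.log_neg hδ0 hδ1)
  set W := ∑ k, w k with hW
  have hle : ∀ k, w k ≤ W := fun k => single_le_sum (fun i _ => (hw i).le) (mem_univ k)
  have he : 0 ≤ (W - w j) / δ := div_nonneg (by linarith [hle j]) hδ0.le
  -- An end position lacks a neighbour; the subtracted boundary term then already outweighs the
  -- whole main term.
  by_cases hj : j = 0 ∨ j = Fin.last n
  · have h1 : w j ≤ w 0 + w (Fin.last n) := by
      rcases hj with rfl | rfl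
      · linarith [hw (Fin.last n)]
      · linarith [hw 0]
    have h2 := neighborDiv_nonneg hw
    have h3 : (W - 2 * (W - w j)) * -Real.log δ ≤ w j * -Real.log δ :=
      mul_le_mul_of_nonneg_right (by linarith [hle j]) hΛ.le
    have h4 := mul_le_mul_of_nonneg_left h1 hΛ.le
    rw [mul_div_assoc]
    linarith
  · push Not at hj
    obtain ⟨i, rfl⟩ := Fin.exists_succ_eq.2 hj.1
    obtain ⟨i', hi'⟩ := Fin.exists_castSucc_eq.2 hj.2
    have hne : i ≠ i' := by
      rintro rfl
      exact (Fin.castSucc_lt_succ (i := i)).ne hi'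
    have hnb : ∀ k, k ≠ i.succ → w k ≤ W - w i.succ := by
      intro k hk
      have := add_le_sum (f := w) (fun k _ => (hw k).le) (mem_univ k) (mem_univ i.succ) hk
      linarith
    have hsum : (w i.succ - w i.castSucc) * (Real.log (w i.succ) - Real.log (w i.castSucc)) +
        (w i'.succ - w i'.castSucc) * (Real.log (w i'.succ) - Real.log (w i'.castSucc)) ≤
        neighborDiv w :=
      add_le_sum (f := fun i : Fin n => (w i.succ - w i.castSucc) *
        (Real.log (w i.succ) - Real.log (w i.castSucc)))
        (fun k _ => sub_mul_log_sub_nonneg (hw _) (hw _)) (mem_univ i) (mem_univ i') hne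
    rw [hi'] at hsum
    have h1 := edge_div_ge (W := W) (e := W - w i.succ) hδ0 hδ1 (by linarith [hw i.succ])
      (hw i.castSucc) (hnb _ (Fin.castSucc_lt_succ).ne)
    have h2 := edge_div_ge (W := W) (e := W - w i.succ) hδ0 hδ1 (by linarith [hw i.succ])
      (hw i'.succ) (hnb _ (by rw [← hi']; exact (Fin.castSucc_lt_succ).ne'))
    rw [sub_sub_cancel] at h1 h2
    have h3 : 0 ≤ 2 * -Real.log δ * (w 0 + w (Fin.last n)) := by
      have := hw 0
      have := hw (Fin.last n)
      positivity
    rw [mul_div_assoc]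
    linarith

/-- The coefficient of the total mass in the terminal bound. -/
noncomputable def gainCoeff (p ε δ : ℝ) : ℝ :=
  -(Real.log 2 / natCapacity p) - collisionWeight p ε + 2 * -Real.log δ / noiseDiv p

/-- The coefficient of the error in the terminal bound. -/
noncomputable def errCoeff (n : ℕ) (p δ : ℝ) : ℝ :=
  Real.log (n + 1) / natCapacity p + (4 * -Real.log δ + 2 / δ) / noiseDiv p

lemma errCoeff_nonneg {n : ℕ} {p δ : ℝ} (hp0 : 0 < p) (hp1 : p < 1 / 2) (hδ0 : 0 < δ)
    (hδ1 : δ < 1) : 0 ≤ errCoeff n p δ := by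
  have hI := natCapacity_pos hp1
  have hD := noiseDiv_pos hp0 hp1
  have hΛ : 0 < -Real.log δ := neg_pos.2 (Real.log_neg hδ0 hδ1)
  have : 0 ≤ Real.log ((n : ℝ) + 1) := Real.log_nonneg (by linarith [n.cast_nonneg (α := ℝ)])
  unfold errCoeff
  positivity

/-- The potential, compensated for the positions `0` and `n` that have only one neighbour. -/
noncomputable def boundaryPotential {n : ℕ} (p ε δ : ℝ) (w : Fin (n + 1) → ℝ) : ℝ :=
  potential p (collisionWeight p ε) w + 2 * -Real.log δ / noiseDiv p * (w 0 + w (Fin.last n))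

lemma boundaryPotential_ge {n : ℕ} {p ε δ : ℝ} {w : Fin (n + 1) → ℝ} (hp0 : 0 < p)
    (hp1 : p < 1 / 2) (hε : 0 < ε) (hδ0 : 0 < δ) (hδ1 : δ < 1) (hw : ∀ k, 0 < w k)
    (j : Fin (n + 1)) :
    gainCoeff p ε δ * ∑ k, w k - errCoeff n p δ * (∑ k, w k - w j) ≤
      boundaryPotential p ε δ w := by
  have hI := natCapacity_pos hp1
  have hD := noiseDiv_pos hp0 hp1
  have h1 := div_le_div_of_nonneg_right (negEntropy_ge hw j) hI.le
  have h2 := div_le_div_of_nonneg_right (neighborDiv_ge hw hδ0 hδ1 j) hD.le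
  have h3 := mul_le_mul_of_nonneg_left (collision_le_sum hw) (collisionWeight_nonneg (p := p) hε)
  unfold boundaryPotential potential gainCoeff errCoeff
  refine le_trans (le_of_eq ?_) (add_le_add_left (sub_le_sub (add_le_add h1 h2) h3) _)
  ring

lemma boundaryPotential_one_le {n : ℕ} {p ε δ : ℝ} (hε : 0 < ε) :
    boundaryPotential p ε δ (fun _ : Fin (n + 1) => (1 : ℝ)) ≤
      -((n + 1) * Real.log (n + 1) / natCapacity p) + 4 * -Real.log δ / noiseDiv p := by
  have h : 0 ≤ collisionWeight p ε * collision fun _ : Fin (n + 1) => (1 : ℝ) :=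
    mul_nonneg (collisionWeight_nonneg hε) (collision_nonneg fun _ => one_pos)
  have h2 : neighborDiv (fun _ : Fin (n + 1) => (1 : ℝ)) = 0 := by simp [neighborDiv]
  have h3 : negEntropy (fun _ : Fin (n + 1) => (1 : ℝ)) = -((n + 1) * Real.log (n + 1)) := by
    simp [negEntropy]
  unfold boundaryPotential potential
  rw [h2, h3]
  refine le_trans (add_le_add_left (sub_le_self _ h) _) (le_of_eq ?_)
  ring

/-- The boundary compensation is linear in `w`, so summing over the two answers preserves it. -/
lemma boundaryPotential_reweight_le {n : ℕ} {p ε δ : ℝ} {τ : Fin (n + 1) → Bool}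
    {w : Fin (n + 1) → ℝ} (hp0 : 0 < p) (hp1 : p < 1 / 2) (hε : 0 < ε) (hτ : SingleJump τ)
    (hw : ∀ k, 0 < w k) :
    boundaryPotential p ε δ (reweight p τ true w) +
      boundaryPotential p ε δ (reweight p τ false w) ≤
    boundaryPotential p ε δ w + (1 + ε) * ∑ k, w k := by
  have h := potential_reweight_le hp0 hp1 hε hτ hw
  unfold boundaryPotential
  rw [← reweight_true_add_false (p := p) (τ := τ) (w := w) 0,
    ← reweight_true_add_false (p := p) (τ := τ) (w := w) (Fin.last n)]
  linarith

/-! ### Decision trees -/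

/-- The expected number of queries among the next `t` steps, from the record `h`, if the
noise-free answers are given by `τ`. -/
noncomputable def treeCost {Q O : Type*} (p : ℝ) (nx : List Bool → Q ⊕ O) (τ : Q → Bool) :
    ℕ → List Bool → ℝ
  | 0, _ => 0
  | t + 1, h =>
    match nx h with
    | .inl q => 1 + (p * treeCost p nx τ t (h ++ [!τ q]) + (1 - p) * treeCost p nx τ t (h ++ [τ q]))
    | .inr _ => 0

open Classical in
/-- The probability, from the record `h`, that `k` has not been output after `t` more steps. -/
noncomputable def treeErr {Q O : Type*} (p : ℝ) (nx : List Bool → Q ⊕ O) (τ : Q → Bool) (k : O) :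
    ℕ → List Bool → ℝ
  | 0, h => if nx h = .inr k then 0 else 1
  | t + 1, h =>
    match nx h with
    | .inl q => p * treeErr p nx τ k t (h ++ [!τ q]) + (1 - p) * treeErr p nx τ k t (h ++ [τ q])
    | .inr j => if j = k then 0 else 1

lemma sum_mul_mixture {ι : Type*} [Fintype ι] (p : ℝ) (τ : ι → Bool) (w : ι → ℝ)
    (f : ι → Bool → ℝ) :
    ∑ k, w k * (p * f k (!τ k) + (1 - p) * f k (τ k)) =
      ∑ k, reweight p τ true w k * f k true + ∑ k, reweight p τ false w k * f k false := by
  rw [← sum_add_distrib]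
  refine sum_congr rfl fun k _ => ?_
  unfold reweight
  cases τ k <;> simp <;> ring

/-- Optional stopping by induction on the remaining steps: the weights on entering each child carry
the likelihood of the answer, so the two inductive bounds simply add. -/
lemma tree_bound {n : ℕ} {Q : Type*} {p a b c : ℝ} (hp0 : 0 < p) (hp1 : p < 1) (hb : 0 ≤ b)
    (Φ : (Fin (n + 1) → ℝ) → ℝ) (nx : List Bool → Q ⊕ Fin (n + 1)) (τ : Fin (n + 1) → Q → Bool)
    (hstep : ∀ (q : Q) (w : Fin (n + 1) → ℝ), (∀ k, 0 < w k) →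
      Φ (reweight p (fun k => τ k q) true w) + Φ (reweight p (fun k => τ k q) false w) ≤
        Φ w + c * ∑ k, w k)
    (hleaf : ∀ (j : Fin (n + 1)) (w : Fin (n + 1) → ℝ), (∀ k, 0 < w k) →
      a * ∑ k, w k - b * (∑ k, w k - w j) ≤ Φ w) (t : ℕ) :
    ∀ (h : List Bool) (w : Fin (n + 1) → ℝ), (∀ k, 0 < w k) →
      a * ∑ k, w k - b * ∑ k, w k * treeErr p nx (τ k) k t h ≤
        Φ w + c * ∑ k, w k * treeCost p nx (τ k) t h := by
  have houtput : ∀ (j : Fin (n + 1)) (w : Fin (n + 1) → ℝ), (∀ k, 0 < w k) →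
      a * ∑ k, w k - b * ∑ k, w k * (if j = k then 0 else 1) ≤ Φ w := by
    intro j w hw
    refine le_trans (le_of_eq ?_) (hleaf j w hw)
    congr 2
    have hj : w j = ∑ k, if j = k then w k else 0 := by simp
    rw [hj, ← sum_sub_distrib]
    refine sum_congr rfl fun k _ => ?_
    split_ifs <;> simp
  induction t with
  | zero =>
    intro h w hw
    rcases hh : nx h with q | j
    -- Cut off while still querying: the whole mass counts as error, so the leaf bound at any
    -- position is more than enough; 0 is arbitrary.
    · have := hleaf 0 w hw
      simp only [treeErr, treeCost, hh, reduceCtorEq, if_false, mul_one, mul_zero,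
        sum_const_zero, add_zero]
      have h0 := mul_nonneg hb (hw 0).le
      linarith
    · simpa [treeErr, treeCost, hh] using houtput j w hw
  | succ t ih =>
    intro h w hw
    rcases hh : nx h with q | j
    · have hT := ih (h ++ [true]) _ (reweight_pos (τ := fun k => τ k q) hp0 hp1 hw true)
      have hF := ih (h ++ [false]) _ (reweight_pos (τ := fun k => τ k q) hp0 hp1 hw false)
      have hs := hstep q w hw
      have he := sum_mul_mixture p (fun k => τ k q) w fun k x =>
        treeErr p nx (τ k) k t (h ++ [x])
      have hc := sum_mul_mixture p (fun k => τ k q) w fun k x =>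
        treeCost p nx (τ k) t (h ++ [x])
      have hW : ∑ k, w k = ∑ k, reweight p (fun k => τ k q) true w k +
          ∑ k, reweight p (fun k => τ k q) false w k := by
        rw [← sum_add_distrib]
        exact sum_congr rfl fun k _ => (reweight_true_add_false k).symm
      simp only [treeErr, treeCost, hh, mul_add (w _) 1, mul_one]
      rw [sum_add_distrib, he, hc]
      have hW' := congrArg (a * ·) hW
      linarith
    · simpa [treeErr, treeCost, hh] using houtput j w hw

end NoisySearch

namespace NoisySearch

open MeasureTheory ProbabilityTheory Finset
open scoped ENNReal

/-! ### The first bit of the noise -/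

/-- Prepend a bit to a sequence of bits. -/
def consBit (b : Bool) (z : ℕ → Bool) : ℕ → Bool
  | 0 => b
  | i + 1 => z i

lemma measurable_consBit : Measurable fun x : Bool × (ℕ → Bool) => consBit x.1 x.2 := by
  refine measurable_pi_iff.2 fun i => ?_
  cases i with
  | zero => exact measurable_fst
  | succ i => exact (measurable_pi_apply i).comp measurable_snd

instance (p : unitInterval) : IsProbabilityMeasure (noise p) := by
  unfold noise
  infer_instance

/-- Product measures are determined by finite boxes, and a box pulls back to a condition on the
first bit times a shifted box. -/
lemma map_consBit_noise (p : unitInterval) :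
    ((bernoulliMeasure true false p).prod (noise p)).map (fun x => consBit x.1 x.2) = noise p := by
  refine Measure.eq_infinitePi _ fun s t ht => ?_
  classical
  rw [Measure.map_apply measurable_consBit (MeasurableSet.pi s.countable_toSet fun i _ => ht i)]
  set s' : Finset ℕ := s.preimage Nat.succ Nat.succ_injective.injOn with hs'
  have hpre : (fun x : Bool × (ℕ → Bool) => consBit x.1 x.2) ⁻¹' Set.pi (↑s) t =
      (if 0 ∈ s then t 0 else Set.univ) ×ˢ Set.pi (↑s') fun i => t (i + 1) := by
    ext ⟨b, z⟩
    simp only [Set.mem_preimage, Set.mem_pi, Set.mem_prod, mem_coe, hs', mem_preimage]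
    constructor
    · intro h
      refine ⟨?_, fun i hi => h (i + 1) hi⟩
      split_ifs with h0
      · exact h 0 h0
      · trivial
    · rintro ⟨h0, h1⟩ i hi
      cases i with
      | zero => rw [if_pos hi] at h0; exact h0
      | succ i => exact h1 i hi
  rw [hpre, Measure.prod_prod, noise, Measure.infinitePi_pi _ fun i _ => ht _]
  have hprod : ∏ i ∈ s', (bernoulliMeasure true false p) (t (i + 1)) =
      ∏ i ∈ s.erase 0, (bernoulliMeasure true false p) (t i) := by
    refine prod_bij (fun i _ => i + 1) ?_ ?_ ?_ ?_
    · intro i hi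
      simpa [hs'] using hi
    · intro i _ j _ h
      simpa using h
    · intro i hi
      obtain ⟨h0, hi⟩ := mem_erase.1 hi
      obtain ⟨j, rfl⟩ := Nat.exists_eq_succ_of_ne_zero h0
      exact ⟨j, by simpa [hs'] using hi, rfl⟩
    · simp
  rw [hprod]
  split_ifs with h0
  · exact mul_prod_erase s (fun i => (bernoulliMeasure true false p) (t i)) h0
  · rw [erase_eq_of_notMem h0, measure_univ, one_mul]

lemma lintegral_noise (p : unitInterval) {F : (ℕ → Bool) → ℝ≥0∞} (hF : Measurable F) :
    ∫⁻ z, F z ∂noise p =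
      ENNReal.ofReal p * ∫⁻ z, F (consBit true z) ∂noise p +
        ENNReal.ofReal (1 - p) * ∫⁻ z, F (consBit false z) ∂noise p := by
  conv_lhs => rw [← map_consBit_noise p]
  rw [lintegral_map hF measurable_consBit,
    lintegral_prod (fun x : Bool × (ℕ → Bool) => F (consBit x.1 x.2))
      (hF.comp measurable_consBit).aemeasurable, bernoulliMeasure_def,
    lintegral_add_measure, lintegral_smul_measure, lintegral_smul_measure, lintegral_dirac,
    lintegral_dirac]
  congr 2
  · simp only [Real.toNNReal_of_nonneg p.2.1]
    rfl
  · simp only [Real.toNNReal_of_nonneg (sub_nonneg.2 p.2.2)]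
    rfl

/-! ### Runs of a decision tree -/

section Record

variable {Q O : Type*} {nx : List Bool → Q ⊕ O} {τ : Q → Bool}

/-- The record of answers after `t` more steps from the record `h`, with noise `z`. -/
def record (nx : List Bool → Q ⊕ O) (τ : Q → Bool) (z : ℕ → Bool) (h : List Bool) :
    ℕ → List Bool
  | 0 => h
  | t + 1 =>
    match nx (record nx τ z h t) with
    | .inl q => record nx τ z h t ++ [xor (τ q) (z t)]
    | .inr _ => record nx τ z h t

/-- Runs are defined by appending the last step, trees by splitting off the first; this reconciles
the two recursions. -/
lemma record_consBit {h : List Bool} {q : Q} (hq : nx h = .inl q) (b : Bool) (z : ℕ → Bool)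
    (t : ℕ) :
    record nx τ (consBit b z) h (t + 1) = record nx τ z (h ++ [xor (τ q) b]) t := by
  induction t with
  | zero => simp [record, hq, consBit]
  | succ t ih =>
    rw [record, ih]
    conv_rhs => rw [record]
    rfl

lemma record_of_inr {h : List Bool} {k : O} (hk : nx h = .inr k) (z : ℕ → Bool) (t : ℕ) :
    record nx τ z h t = h := by
  induction t with
  | zero => rfl
  | succ t ih => rw [record, ih, hk]

lemma measurable_comp_of_finite {S B : Type*} [MeasurableSpace S] [Finite B] {f : S → B}
    (hf : ∀ b, MeasurableSet {s | f s = b}) {G : B → S → ℝ≥0∞} (hG : ∀ b, Measurable (G b)) :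
    Measurable fun s => G (f s) s := by
  classical
  let _ := Fintype.ofFinite B
  have : (fun s => G (f s) s) = fun s => ∑ b, {s | f s = b}.indicator (G b) s := by
    funext s
    simp [Set.indicator_apply]
  rw [this]
  exact Finset.measurable_fun_sum _ fun b _ => (hG b).indicator (hf b)

/-- The statement ranges over all `g` depending on both record and seed, because the inductive step
replaces `g` by its composition with one seed-dependent action. -/
lemma measurable_comp_record {S : Type*} [MeasurableSpace S] [Finite Q] [Finite O]
    {nx : S → List Bool → Q ⊕ O} (hnx : ∀ h b, MeasurableSet {s | nx s h = b}) (h : List Bool)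
    (t : ℕ) :
    ∀ {g : List Bool → S → ℝ≥0∞}, (∀ h, Measurable (g h)) →
      Measurable fun ω : S × (ℕ → Bool) => g (record (nx ω.1) τ ω.2 h t) ω.1 := by
  induction t with
  | zero => exact fun hg => (hg h).comp measurable_fst
  | succ t ih =>
    intro g hg
    let G (b : Bool) (l : List Bool) (s : S) : ℝ≥0∞ :=
      match nx s l with
      | .inl q => g (l ++ [xor (τ q) b]) s
      | .inr _ => g l s
    have hG : ∀ b l, Measurable (G b l) := by
      intro b l
      refine measurable_comp_of_finite (f := fun s => nx s l) (G := fun c s =>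
        match c with
        | .inl q => g (l ++ [xor (τ q) b]) s
        | .inr _ => g l s) (hnx l) ?_
      rintro (q | j)
      · exact hg _
      · exact hg _
    have heq : (fun ω : S × (ℕ → Bool) => g (record (nx ω.1) τ ω.2 h (t + 1)) ω.1) =
        fun ω => if ω.2 t = true then G true (record (nx ω.1) τ ω.2 h t) ω.1
          else G false (record (nx ω.1) τ ω.2 h t) ω.1 := by
      funext ω
      simp only [G, record]
      cases hn : nx ω.1 (record (nx ω.1) τ ω.2 h t) <;> cases hz : ω.2 t <;> simp
    rw [heq]
    refine Measurable.ite ?_ (ih (hG true)) (ih (hG false))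
    exact ((measurable_pi_apply t).comp (measurable_snd (α := S) (β := ℕ → Bool)))
      (measurableSet_singleton true)

lemma measurable_comp_record_noise [Finite Q] [Finite O] (g : List Bool → ℝ≥0∞) (h : List Bool)
    (t : ℕ) : Measurable fun z : ℕ → Bool => g (record nx τ z h t) :=
  (measurable_comp_record (S := Unit) (nx := fun _ => nx) (τ := τ)
    (fun _ _ => trivial) h t (g := fun l _ => g l) fun _ => measurable_const).comp
    (measurable_prodMk_left (x := ()))

lemma treeCost_nonneg {p : ℝ} (hp0 : 0 ≤ p) (hp1 : p ≤ 1) (t : ℕ) :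
    ∀ h, 0 ≤ treeCost p nx τ t h := by
  have : 0 ≤ 1 - p := sub_nonneg.2 hp1
  induction t with
  | zero => intro h; simp [treeCost]
  | succ t ih =>
    intro h
    rcases hh : nx h with q | j
    · have h1 := ih (h ++ [!τ q])
      have h2 := ih (h ++ [τ q])
      simp only [treeCost, hh]
      positivity
    · simp [treeCost, hh]

lemma treeErr_nonneg {p : ℝ} (hp0 : 0 ≤ p) (hp1 : p ≤ 1) (k : O) (t : ℕ) :
    ∀ h, 0 ≤ treeErr p nx τ k t h := by
  have : 0 ≤ 1 - p := sub_nonneg.2 hp1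
  induction t with
  | zero => intro h; simp only [treeErr]; split_ifs <;> simp
  | succ t ih =>
    intro h
    rcases hh : nx h with q | j
    · have h1 := ih (h ++ [!τ q])
      have h2 := ih (h ++ [τ q])
      simp only [treeErr, hh]
      positivity
    · simp only [treeErr, hh]; split_ifs <;> simp

lemma lintegral_queries_eq [Finite Q] [Finite O] (p : unitInterval) (t : ℕ) :
    ∀ h : List Bool, ∫⁻ z, ∑ i ∈ range t,
        (if (nx (record nx τ z h i)).isLeft then 1 else 0) ∂noise p =
      ENNReal.ofReal (treeCost p nx τ t h) := by
  have hp : 0 ≤ 1 - (p : ℝ) := sub_nonneg.2 p.2.2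
  have hmeas : ∀ (t : ℕ) (h : List Bool), Measurable fun z : ℕ → Bool => ∑ i ∈ range t,
      (if (nx (record nx τ z h i)).isLeft then 1 else 0 : ℝ≥0∞) := fun t h =>
    Finset.measurable_fun_sum _ fun i _ =>
      measurable_comp_record_noise (fun l => if (nx l).isLeft then 1 else 0) h i
  induction t with
  | zero => intro h; simp [treeCost]
  | succ t ih =>
    intro h
    rcases hh : nx h with q | j
    · have key : ∀ b, ∫⁻ z, ∑ i ∈ range (t + 1),
          (if (nx (record nx τ (consBit b z) h i)).isLeft then 1 else 0) ∂noise p =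
          ENNReal.ofReal (1 + treeCost p nx τ t (h ++ [xor (τ q) b])) := by
        intro b
        simp only [sum_range_succ', record_consBit hh]
        rw [lintegral_add_left (hmeas t _), ih, add_comm,
          ENNReal.ofReal_add zero_le_one (treeCost_nonneg p.2.1 p.2.2 _ _)]
        simp [record, hh]
      rw [lintegral_noise p (hmeas _ _), key, key,
        ← ENNReal.ofReal_mul p.2.1, ← ENNReal.ofReal_mul hp, ← ENNReal.ofReal_add]
      · simp only [treeCost, hh, Bool.xor_true, Bool.xor_false]
        congr 1
        ring
      · have := treeCost_nonneg (nx := nx) (τ := τ) p.2.1 p.2.2 t (h ++ [xor (τ q) true])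
        have := p.2.1
        positivity
      · have := treeCost_nonneg (nx := nx) (τ := τ) p.2.1 p.2.2 t (h ++ [xor (τ q) false])
        positivity
    · simp [record_of_inr hh, treeCost, hh]

open Classical in
lemma lintegral_error_eq [Finite Q] [Finite O] (p : unitInterval) (k : O)
    (t : ℕ) :
    ∀ h : List Bool, ∫⁻ z, (if nx (record nx τ z h t) = .inr k then 0 else 1) ∂noise p =
      ENNReal.ofReal (treeErr p nx τ k t h) := by
  have hp : 0 ≤ 1 - (p : ℝ) := sub_nonneg.2 p.2.2
  induction t with
  | zero => intro h; simp only [treeErr, record]; split_ifs <;> simp [*]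
  | succ t ih =>
    intro h
    rcases hh : nx h with q | j
    · rw [lintegral_noise p
        (measurable_comp_record_noise (fun l => if nx l = .inr k then 0 else 1) h (t + 1))]
      simp only [record_consBit hh]
      rw [ih, ih, ← ENNReal.ofReal_mul p.2.1, ← ENNReal.ofReal_mul hp, ← ENNReal.ofReal_add]
      · simp only [treeErr, hh, Bool.xor_true, Bool.xor_false]
      · exact mul_nonneg p.2.1 (treeErr_nonneg p.2.1 p.2.2 _ _ _)
      · exact mul_nonneg hp (treeErr_nonneg p.2.1 p.2.2 _ _ _)
    · simp only [record_of_inr hh, treeErr, hh, Sum.inr.injEq]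
      split_ifs <;> simp [*]

end Record

end NoisySearch

namespace NoisySearch

open MeasureTheory Finset Filter Topology
open scoped ENNReal

/-! ### The queries on a sorted list -/

section Truth

variable {n : ℕ} {α : Type*} [LinearOrder α] {a : Fin n → α} {x : Fin (n + 1) → α}

lemma lt_target_iff (ha : Monotone a) (hx : ∀ k, predIndex a (x k) = k) (i : Fin n)
    (k : Fin (n + 1)) : a i < x k ↔ (i : ℕ) < k := by
  rw [← hx k]
  constructor
  · intro h
    exact Finset.le_sup (f := fun i : Fin n => (i : ℕ) + 1)
      (mem_filter.2 ⟨mem_univ i, h⟩)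
  · intro h
    by_contra hn
    refine absurd h (not_lt.2 (Finset.sup_le fun j hj => ?_))
    have hj := (mem_filter.1 hj).2
    exact Nat.succ_le_of_lt (lt_of_not_ge fun hij => hn ((ha (Fin.le_def.2 hij)).trans_lt hj))

lemma monotone_target (ha : Monotone a) (hx : ∀ k, predIndex a (x k) = k) : Monotone x := by
  refine monotone_iff_forall_lt.2 fun k l hkl => ?_
  have hk : (k : ℕ) < n := by have := Fin.lt_def.1 hkl; omega
  have h1 : ¬ a ⟨k, hk⟩ < x k := by simp [lt_target_iff ha hx]
  have h2 : a ⟨k, hk⟩ < x l := by simpa [lt_target_iff ha hx] using hkl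
  exact (not_lt.1 h1).trans h2.le

/-- A target may equal a list element, so the index alone does not determine whether `x k < a i`;
monotonicity of the targets still leaves at most one jump. -/
lemma singleJump_truth (hx : Monotone x) (q : Query n) :
    SingleJump fun k => q.truth a (x k) := by
  cases q with
  | elemLtTarget i =>
    refine SingleJump.of_monotone fun k l hkl => ?_
    simp only [Query.truth]
    by_cases h : a i < x k
    · simp [h, h.trans_le (hx hkl)]
    · simp [h]
  | targetLtElem i =>
    refine SingleJump.of_antitone fun k l hkl => ?_
    simp only [Query.truth]
    by_cases h : x l < a i
    · simp [h, (hx hkl).trans_lt h]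
    · simp [h]

end Truth

instance (n : ℕ) : Finite (Query n) :=
  Finite.of_surjective (Sum.elim Query.elemLtTarget Query.targetLtElem : Fin n ⊕ Fin n → Query n)
    fun q => by
      cases q with
      | elemLtTarget i => exact ⟨.inl i, rfl⟩
      | targetLtElem i => exact ⟨.inr i, rfl⟩

/-- The potential that has to be gained by an algorithm without error. -/
noncomputable def totalGain (n : ℕ) (p ε δ : ℝ) : ℝ :=
  gainCoeff p ε δ * (n + 1) + (n + 1) * Real.log (n + 1) / natCapacity p -
    4 * -Real.log δ / noiseDiv p

lemma totalGain_le {n : ℕ} {Q : Type*} {p ε δ : ℝ} (hp0 : 0 < p) (hp1 : p < 1 / 2) (hε : 0 < ε)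
    (hδ0 : 0 < δ) (hδ1 : δ < 1) (nx : List Bool → Q ⊕ Fin (n + 1)) (τ : Fin (n + 1) → Q → Bool)
    (hτ : ∀ q, SingleJump fun k => τ k q) (t : ℕ) :
    totalGain n p ε δ ≤ errCoeff n p δ * ∑ k, treeErr p nx (τ k) k t [] +
      (1 + ε) * ∑ k, treeCost p nx (τ k) t [] := by
  have h := tree_bound hp0 (by linarith) (errCoeff_nonneg (n := n) hp0 hp1 hδ0 hδ1)
    (boundaryPotential p ε δ) nx τ
    (fun q w hw => boundaryPotential_reweight_le hp0 hp1 hε (hτ q) hw)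
    (fun j w hw => boundaryPotential_ge hp0 hp1 hε hδ0 hδ1 hw j) t [] (fun _ => 1)
    fun _ => one_pos
  have h1 := boundaryPotential_one_le (n := n) (p := p) (δ := δ) hε
  simp only [sum_const, card_univ, Fintype.card_fin, nsmul_eq_mul, mul_one, one_mul] at h
  push_cast at h
  unfold totalGain
  linarith

lemma lintegral_combination {Ω ι : Type*} [Fintype ι] [MeasurableSpace Ω] (ν : Measure Ω)
    (b c : ℝ≥0∞) {F G : ι → Ω → ℝ≥0∞} (hF : ∀ k, Measurable (F k)) (hG : ∀ k, Measurable (G k)) :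
    ∫⁻ ω, (b * ∑ k, F k ω + c * ∑ k, G k ω) ∂ν =
      b * ∑ k, ∫⁻ ω, F k ω ∂ν + c * ∑ k, ∫⁻ ω, G k ω ∂ν := by
  have hF' : Measurable fun ω => ∑ k, F k ω := Finset.measurable_fun_sum _ fun k _ => hF k
  have hG' : Measurable fun ω => ∑ k, G k ω := Finset.measurable_fun_sum _ fun k _ => hG k
  rw [lintegral_add_left (hF'.const_mul b), lintegral_const_mul b hF',
    lintegral_const_mul c hG', lintegral_finsetSum _ fun k _ => hF k,
    lintegral_finsetSum _ fun k _ => hG k]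

/-! ### Runs of a randomized algorithm and removal of the truncation -/

namespace Algorithm

variable {n : ℕ} {S : Type*} [MeasurableSpace S] {α : Type*} [LinearOrder α]

lemma answers_eq_record (A : Algorithm n S) (a : Fin n → α) (x : α) (s : S) (z : ℕ → Bool)
    (t : ℕ) : A.answers a x s z t = record (A.next s) (Query.truth a x) z [] t := by
  induction t with
  | zero => rfl
  | succ t ih =>
    rw [answers, record, ih]
    cases A.next s (record (A.next s) (Query.truth a x) z [] t) <;> rfl

lemma measurable_comp_answers (A : Algorithm n S) (a : Fin n → α) (x : α) (t : ℕ)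
    (g : Query n ⊕ Fin (n + 1) → ℝ≥0∞) :
    Measurable fun ω : S × (ℕ → Bool) => g (A.next ω.1 (A.answers a x ω.1 ω.2 t)) := by
  simp only [answers_eq_record]
  exact measurable_comp_record A.measurable_next [] t (g := fun l s => g (A.next s l))
    fun h => measurable_comp_of_finite (f := fun s => A.next s h) (G := fun b _ => g b)
      (A.measurable_next h) fun _ => measurable_const

/-- The number of queries within the first `t` steps. -/
noncomputable def queriesUpTo (A : Algorithm n S) (a : Fin n → α) (x : α) (t : ℕ)
    (ω : S × (ℕ → Bool)) : ℝ≥0∞ :=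
  ∑ i ∈ range t, if (A.next ω.1 (A.answers a x ω.1 ω.2 i)).isLeft then 1 else 0

open Classical in
/-- The indicator of not having output `k` by step `t`. -/
noncomputable def failsUpTo (A : Algorithm n S) (a : Fin n → α) (x : α) (k : Fin (n + 1)) (t : ℕ)
    (ω : S × (ℕ → Bool)) : ℝ≥0∞ :=
  if A.next ω.1 (A.answers a x ω.1 ω.2 t) = .inr k then 0 else 1

lemma lintegral_failsUpTo (A : Algorithm n S) (p : unitInterval) (a : Fin n → α) (x : α)
    (k : Fin (n + 1)) (t : ℕ) (s : S) :
    ∫⁻ z, A.failsUpTo a x k t (s, z) ∂noise p =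
      ENNReal.ofReal (treeErr p (A.next s) (Query.truth a x) k t []) := by
  rw [← lintegral_error_eq]
  refine lintegral_congr fun z => ?_
  rw [failsUpTo, answers_eq_record]
  by_cases h : A.next s (record (A.next s) (Query.truth a x) z [] t) = .inr k <;> simp [h]

lemma measurable_queriesUpTo (A : Algorithm n S) (a : Fin n → α) (x : α) (t : ℕ) :
    Measurable (A.queriesUpTo a x t) :=
  Finset.measurable_fun_sum _ fun i _ =>
    A.measurable_comp_answers a x i fun b => if b.isLeft then 1 else 0

open Classical in
lemma measurable_failsUpTo (A : Algorithm n S) (a : Fin n → α) (x : α) (k : Fin (n + 1))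
    (t : ℕ) : Measurable (A.failsUpTo a x k t) :=
  A.measurable_comp_answers a x t fun b => if b = .inr k then 0 else 1

lemma lintegral_queriesUpTo_le (A : Algorithm n S) (μ : Measure S) (p : unitInterval)
    (a : Fin n → α) (x : α) (t : ℕ) :
    ∫⁻ ω, A.queriesUpTo a x t ω ∂(μ.prod (noise p)) ≤ A.expectedQueries μ p a x :=
  lintegral_mono fun _ => ENNReal.sum_le_tsum _

lemma next_answers_of_le (A : Algorithm n S) (a : Fin n → α) (x : α) (s : S) (z : ℕ → Bool)
    {k : Fin (n + 1)} {t u : ℕ} (htu : t ≤ u) (h : A.next s (A.answers a x s z t) = .inr k) :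
    A.next s (A.answers a x s z u) = .inr k := by
  induction u, htu using Nat.le_induction with
  | base => exact h
  | succ u _ ih => rw [answers, ih]; exact ih

/-- An output is never revised, so the failure events decrease in `t`, and their intersection is the
error event; continuity from above applies. -/
lemma tendsto_lintegral_failsUpTo (A : Algorithm n S) (μ : Measure S) [IsProbabilityMeasure μ]
    (p : unitInterval) (a : Fin n → α) (x : α) (k : Fin (n + 1)) (hk : predIndex a x = k) :
    Tendsto (fun t => ∫⁻ ω, A.failsUpTo a x k t ω ∂(μ.prod (noise p))) atTop
      (𝓝 (A.errorProb μ p a x)) := by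
  let E : ℕ → Set (S × (ℕ → Bool)) := fun t =>
    {ω | A.next ω.1 (A.answers a x ω.1 ω.2 t) ≠ .inr k}
  have hE : ∀ t, MeasurableSet (E t) := by
    intro t
    have : E t = A.failsUpTo a x k t ⁻¹' {1} := by
      ext ω
      simp [E, failsUpTo]
    rw [this]
    exact A.measurable_failsUpTo a x k t (measurableSet_singleton _)
  have hint : ∀ t, ∫⁻ ω, A.failsUpTo a x k t ω ∂(μ.prod (noise p)) = (μ.prod (noise p)) (E t) := by
    intro t
    rw [← lintegral_indicator_one (hE t)]
    refine lintegral_congr fun ω => ?_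
    by_cases h : A.next ω.1 (A.answers a x ω.1 ω.2 t) = .inr k <;> simp [failsUpTo, E, h]
  have hinter : {ω : S × (ℕ → Bool) | ¬ ∃ k : Fin (n + 1), (k : ℕ) = predIndex a x ∧
      A.Outputs a x ω.1 ω.2 k} = ⋂ t, E t := by
    ext ω
    simp only [Set.mem_ofPred_eq, Set.mem_iInter, E, Outputs, hk]
    constructor
    · intro h t ht
      exact h ⟨k, rfl, t, ht⟩
    · rintro h ⟨l, hl, t, ht⟩
      rw [Fin.ext hl] at ht
      exact h t ht
  simp only [hint, errorProb, hinter]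
  refine tendsto_measure_iInter_atTop (fun t => (hE t).nullMeasurableSet) ?_
    ⟨0, measure_ne_top _ _⟩
  intro t u htu ω hω h
  exact hω (A.next_answers_of_le a x ω.1 ω.2 htu h)

lemma ofReal_totalGain_le (A : Algorithm n S) (μ : Measure S) [IsProbabilityMeasure μ]
    {p : unitInterval} {ε δ : ℝ} (hp0 : 0 < (p : ℝ)) (hp1 : (p : ℝ) < 1 / 2) (hε : 0 < ε)
    (hδ0 : 0 < δ) (hδ1 : δ < 1) {a : Fin n → α} {x : Fin (n + 1) → α} (ha : Monotone a)
    (hx : ∀ k, predIndex a (x k) = k) :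
    ENNReal.ofReal (totalGain n p ε δ) ≤
      ENNReal.ofReal (errCoeff n p δ) * ∑ k, A.errorProb μ p a (x k) +
        ENNReal.ofReal (1 + ε) * ∑ k, A.expectedQueries μ p a (x k) := by
  have hb := errCoeff_nonneg (n := n) hp0 hp1 hδ0 hδ1
  have hfinite : ∀ t, ENNReal.ofReal (totalGain n p ε δ) ≤
      ENNReal.ofReal (errCoeff n p δ) *
        ∑ k, ∫⁻ ω, A.failsUpTo a (x k) k t ω ∂(μ.prod (noise p)) +
      ENNReal.ofReal (1 + ε) * ∑ k, A.expectedQueries μ p a (x k) := by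
    intro t
    -- For a fixed seed the algorithm is a decision tree. The bound is affine in error and cost,
    -- hence survives averaging over seeds without any error guarantee for each one.
    have hseed : ∀ s, ENNReal.ofReal (totalGain n p ε δ) ≤
        ∫⁻ z, (ENNReal.ofReal (errCoeff n p δ) * ∑ k, A.failsUpTo a (x k) k t (s, z) +
          ENNReal.ofReal (1 + ε) * ∑ k, A.queriesUpTo a (x k) t (s, z)) ∂noise p := by
      intro s
      rw [lintegral_combination (noise p) _ _ (F := fun k z => A.failsUpTo a (x k) k t (s, z))
        (G := fun k z => A.queriesUpTo a (x k) t (s, z))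
        (fun k => (A.measurable_failsUpTo a (x k) k t).comp measurable_prodMk_left)
        (fun k => (A.measurable_queriesUpTo a (x k) t).comp measurable_prodMk_left)]
      simp only [lintegral_failsUpTo, queriesUpTo, answers_eq_record, lintegral_queries_eq]
      have h := totalGain_le hp0 hp1 hε hδ0 hδ1 (A.next s) (fun k => Query.truth a (x k))
        (singleJump_truth (monotone_target ha hx)) t
      have he : ∀ k, 0 ≤ treeErr p (A.next s) (Query.truth a (x k)) k t [] :=
        fun k => treeErr_nonneg p.2.1 p.2.2 _ _ _
      have hc : ∀ k, 0 ≤ treeCost p (A.next s) (Query.truth a (x k)) t [] :=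
        fun k => treeCost_nonneg p.2.1 p.2.2 _ _
      rw [← ENNReal.ofReal_sum_of_nonneg fun k _ => he k,
        ← ENNReal.ofReal_sum_of_nonneg fun k _ => hc k, ← ENNReal.ofReal_mul hb,
        ← ENNReal.ofReal_mul (by positivity), ← ENNReal.ofReal_add
          (mul_nonneg hb (sum_nonneg fun k _ => he k))
          (mul_nonneg (by positivity) (sum_nonneg fun k _ => hc k))]
      exact ENNReal.ofReal_le_ofReal h
    have hmeas : Measurable fun ω =>
        (ENNReal.ofReal (errCoeff n p δ) * ∑ k, A.failsUpTo a (x k) k t ω +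
          ENNReal.ofReal (1 + ε) * ∑ k, A.queriesUpTo a (x k) t ω) :=
      ((Finset.measurable_fun_sum _ fun k _ => A.measurable_failsUpTo a (x k) k t).const_mul
        _).add ((Finset.measurable_fun_sum _ fun k _ =>
          A.measurable_queriesUpTo a (x k) t).const_mul _)
    calc ENNReal.ofReal (totalGain n p ε δ)
        = ∫⁻ _, ENNReal.ofReal (totalGain n p ε δ) ∂μ := by simp
      _ ≤ _ := lintegral_mono hseed
      _ = ∫⁻ ω, (ENNReal.ofReal (errCoeff n p δ) * ∑ k, A.failsUpTo a (x k) k t ω +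
          ENNReal.ofReal (1 + ε) * ∑ k, A.queriesUpTo a (x k) t ω) ∂(μ.prod (noise p)) :=
        (lintegral_prod _ hmeas.aemeasurable).symm
      _ = ENNReal.ofReal (errCoeff n p δ) *
            ∑ k, ∫⁻ ω, A.failsUpTo a (x k) k t ω ∂(μ.prod (noise p)) +
          ENNReal.ofReal (1 + ε) * ∑ k, ∫⁻ ω, A.queriesUpTo a (x k) t ω ∂(μ.prod (noise p)) :=
        lintegral_combination _ _ _ (fun k => A.measurable_failsUpTo a (x k) k t)
          (fun k => A.measurable_queriesUpTo a (x k) t)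
      _ ≤ _ := by
        gcongr with k
        exact A.lintegral_queriesUpTo_le μ p a (x k) t
  refine ge_of_tendsto' (Tendsto.add (ENNReal.Tendsto.const_mul (tendsto_finsetSum _ fun k _ =>
    A.tendsto_lintegral_failsUpTo μ p a (x k) k (hx k)) (Or.inr ENNReal.ofReal_ne_top))
    tendsto_const_nhds) hfinite

end Algorithm

/-! ### The asymptotic form -/

lemma capacity_eq {p : ℝ} : capacity p = natCapacity p / Real.log 2 := by
  have h2 : Real.log 2 ≠ 0 := (Real.log_pos one_lt_two).ne'
  unfold capacity natCapacity Real.logb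
  field_simp
  ring

lemma main_term_le {p ε δ E : ℝ} {n : ℕ} (hp0 : 0 < p) (hp1 : p < 1 / 2) (hε : 0 < ε)
    (hδ0 : 0 < δ) (hδ1 : δ < 1)
    (hn : 4 / ε ≤ n)
    (hK : 2 / ε * (Real.log 2 / natCapacity p + collisionWeight p (ε / 2) + 6 / noiseDiv p) ≤
      (1 - δ) * Real.log n / natCapacity p)
    (hE : totalGain n p (ε / 2) δ ≤
      errCoeff n p δ * (δ * (n + 1)) + (1 + ε / 2) * (E * (n + 1))) :
    (1 - ε) * ((1 - δ) * Real.log n / natCapacity p + 2 * -Real.log δ / noiseDiv p) ≤ E := by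
  have hI := natCapacity_pos hp1
  have hD := noiseDiv_pos hp0 hp1
  have hN : (0 : ℝ) < n + 1 := by positivity
  have hn0 : (0 : ℝ) < n := lt_of_lt_of_le (by positivity) hn
  have hΛ : 0 < -Real.log δ := neg_pos.2 (Real.log_neg hδ0 hδ1)
  set I := natCapacity p
  set D := noiseDiv p
  set C := collisionWeight p (ε / 2)
  have hδlog : δ * -Real.log δ ≤ 1 := by
    have h := Real.log_le_sub_one_of_pos (inv_pos.2 hδ0)
    rw [Real.log_inv] at h
    have h2 := mul_le_mul_of_nonneg_left h hδ0.le
    have h3 : δ * (δ⁻¹ - 1) = 1 - δ := by field_simp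
    linarith
  have hdiv : -(Real.log 2 / I) - C + (1 - δ) * Real.log (n + 1) / I +
      2 * -Real.log δ / D - δ * (4 * -Real.log δ + 2 / δ) / D -
      4 * -Real.log δ / D / (n + 1) ≤ (1 + ε / 2) * E := by
    unfold totalGain gainCoeff errCoeff at hE
    rw [← mul_le_mul_iff_left₀ hN]
    refine le_trans (le_of_eq ?_) (sub_le_iff_le_add'.2 hE |>.trans (le_of_eq (by ring)))
    have : 4 * -Real.log δ / D / (n + 1) * (n + 1) = 4 * -Real.log δ / D := by field_simp
    linear_combination (-1 : ℝ) * this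
  have h1 : δ * (4 * -Real.log δ + 2 / δ) / D ≤ 6 / D := by
    refine div_le_div_of_nonneg_right ?_ hD.le
    -- The constant 6 is 4 + 2, using δ log(1/δ) ≤ 1.
    have : δ * (4 * -Real.log δ + 2 / δ) = 4 * (δ * -Real.log δ) + 2 := by field_simp
    linarith
  have h2 : 4 * -Real.log δ / D / (n + 1) ≤ ε / 2 * (2 * -Real.log δ / D) := by
    have h3 : 4 / ((n : ℝ) + 1) ≤ ε := by
      rw [div_le_iff₀ hN]
      rw [div_le_iff₀ hε] at hn
      nlinarith
    have h4 : 0 ≤ -Real.log δ / D := by positivity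
    have h5 := mul_le_mul_of_nonneg_right h3 h4
    refine le_trans (le_of_eq ?_) (h5.trans (le_of_eq ?_)) <;> ring
  have h3 : (1 - δ) * Real.log n / I ≤ (1 - δ) * Real.log (n + 1) / I := by
    have : 0 < 1 - δ := sub_pos.2 hδ1
    have := Real.log_le_log hn0 (show (n : ℝ) ≤ n + 1 by linarith)
    gcongr
  have h4 : Real.log 2 / I + C + 6 / D ≤ ε / 2 * ((1 - δ) * Real.log n / I) := by
    have h := mul_le_mul_of_nonneg_left hK (show 0 ≤ ε / 2 by positivity)
    refine le_trans (le_of_eq ?_) h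
    field_simp
  set X := (1 - δ) * Real.log n / I
  set Y := 2 * -Real.log δ / D with hY
  have hY0 : 0 ≤ Y := by positivity
  have hC : 0 ≤ C := collisionWeight_nonneg (by positivity)
  have hX0 : 0 ≤ X := by
    have : 0 ≤ Real.log 2 / I + C + 6 / D := by
      have := Real.log_pos one_lt_two
      positivity
    by_contra hneg
    push Not at hneg
    nlinarith
  have h5 : (1 - ε / 2) * (X + Y) ≤ (1 + ε / 2) * E := by linarith
  -- (1 + ε/2)(1 - ε) ≤ 1 - ε/2, which is why the potential is used with ε/2.
  have h6 : (1 + ε / 2) * ((1 - ε) * (X + Y)) ≤ (1 + ε / 2) * E := by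
    refine le_trans ?_ h5
    nlinarith [mul_nonneg (mul_nonneg hε.le hε.le) (add_nonneg hX0 hY0)]
  exact le_of_mul_le_mul_left h6 (by positivity)

end NoisySearch

theorem theorem3 (p : unitInterval) (hp0 : 0 < (p : ℝ)) (hp1 : (p : ℝ) < 1 / 2)
    (ε : ℝ) (hε : 0 < ε) :
    ∃ K : ℝ, ∀ (n : ℕ) (δ : ℝ), 0 < δ → δ < 1 → K ≤ (1 - δ) * Real.logb 2 n →
      ∀ (α : Type*) [LinearOrder α] (a : Fin n → α) (x : Fin (n + 1) → α),
        Monotone a → (∀ k, NoisySearch.predIndex a (x k) = k) →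
      ∀ (S : Type*) [MeasurableSpace S] (μ : MeasureTheory.Measure S)
        [MeasureTheory.IsProbabilityMeasure μ] (A : NoisySearch.Algorithm n S),
        NoisySearch.uniformAverage n (fun k => A.errorProb μ p a (x k)) ≤ ENNReal.ofReal δ →
        ENNReal.ofReal ((1 - ε) *
            ((1 - δ) * Real.logb 2 n / NoisySearch.capacity p +
              2 * Real.logb 2 (1 / δ) /
                ((1 - 2 * (p : ℝ)) * Real.logb 2 ((1 - (p : ℝ)) / (p : ℝ))))) ≤
          NoisySearch.uniformAverage n (fun k => A.expectedQueries μ p a (x k)) := by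
  open NoisySearch in
  have hI := natCapacity_pos hp1
  have hD := noiseDiv_pos hp0 hp1
  have hl2 : 0 < Real.log 2 := Real.log_pos one_lt_two
  set B := 2 / ε * (Real.log 2 / natCapacity p + collisionWeight p (ε / 2) + 6 / noiseDiv p)
    with hB
  have hB0 : 0 ≤ B := by
    have := collisionWeight_nonneg (p := p) (half_pos hε)
    positivity
  -- The first summand dominates the additive constants; the second forces n ≥ 4/ε through log n ≤
  -- n, making the boundary compensation negligible. Dividing by log 2 converts nats to bits.
  refine ⟨B * natCapacity p / Real.log 2 + 4 / ε / Real.log 2, ?_⟩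
  intro n δ hδ0 hδ1 hK α _ a x ha hx S _ μ _ A herr
  have hd0 : 0 < 1 - δ := sub_pos.2 hδ1
  have hK' : B * natCapacity p + 4 / ε ≤ (1 - δ) * Real.log n := by
    rw [← add_div, Real.logb, ← mul_div_assoc] at hK
    exact (div_le_div_iff_of_pos_right hl2).1 hK
  have hlogn : 0 ≤ Real.log n := Real.log_natCast_nonneg n
  have hn : 4 / ε ≤ n := by
    have h1 : (1 - δ) * Real.log n ≤ Real.log n := by nlinarith
    have h2 : Real.log n ≤ n := Real.log_le_self (Nat.cast_nonneg n)
    have h3 : 0 ≤ B * natCapacity p := by positivity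
    linarith
  have hBn : B ≤ (1 - δ) * Real.log n / natCapacity p := by
    rw [le_div_iff₀ hI]
    have : 0 < 4 / ε := by positivity
    linarith
  have hgain := A.ofReal_totalGain_le μ hp0 hp1 (half_pos hε) hδ0 hδ1 ha hx
  have hN0 : ((n : ENNReal) + 1) ≠ 0 := by simp
  have hNt : ((n : ENNReal) + 1) ≠ ⊤ := by simp
  have hNr : ((n : ENNReal) + 1) = ENNReal.ofReal ((n : ℝ) + 1) := by
    rw [ENNReal.ofReal_add (Nat.cast_nonneg n) zero_le_one]
    simp
  unfold uniformAverage at herr ⊢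
  have herr' := (ENNReal.div_le_iff hN0 hNt).1 herr
  set T := ∑ k, A.expectedQueries μ p a (x k) with hT
  by_cases htop : T = ⊤
  · rw [htop, ENNReal.top_div_of_ne_top hNt]
    exact le_top
  have hb := errCoeff_nonneg (n := n) hp0 hp1 hδ0 hδ1
  have hNpos : (0 : ℝ) < n + 1 := by positivity
  have hreal : totalGain n p (ε / 2) δ ≤ errCoeff n p δ * (δ * (n + 1)) +
      (1 + ε / 2) * (T.toReal / (n + 1) * (n + 1)) := by
    rw [div_mul_cancel₀ _ hNpos.ne']
    rw [← ENNReal.ofReal_le_ofReal_iff (by positivity), ENNReal.ofReal_add (by positivity)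
      (by positivity), ENNReal.ofReal_mul hb, ENNReal.ofReal_mul (by positivity),
      ENNReal.ofReal_mul (by positivity), ENNReal.ofReal_toReal htop, ← hNr]
    refine hgain.trans ?_
    gcongr
  have hmain := main_term_le hp0 hp1 hε hδ0 hδ1 hn hBn hreal
  have hEq : T / ((n : ENNReal) + 1) = ENNReal.ofReal (T.toReal / (n + 1)) := by
    rw [ENNReal.ofReal_div_of_pos hNpos, ENNReal.ofReal_toReal htop, ← hNr]
  rw [hEq]
  refine ENNReal.ofReal_le_ofReal (le_trans (le_of_eq ?_) hmain)
  have hq : 0 < 1 - (p : ℝ) := by linarith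
  rw [capacity_eq, Real.logb, Real.logb, Real.logb, one_div, Real.log_inv,
    Real.log_div hq.ne' hp0.ne']
  have hd : Real.log (1 - p) - Real.log p ≠ 0 :=
    (sub_pos.2 (Real.log_lt_log hp0 (by linarith))).ne'
  have h2p : 1 - 2 * (p : ℝ) ≠ 0 := by linarith
  unfold noiseDiv
  congr 2
  · field_simp
  · field_simp
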